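/- Let $N \ge 2$ and let $m_1, \dots, m_N \ge 1$ be integers; write $[m] = \{1, \dots, m\}$. For a point $x = (x_1, \dots, x_N)$ of the grid $[m_1] \times \dots \times [m_N]$ put $\overline{x} := (m_1 - x_1 + 1, \dots, m_N - x_N + 1)$, and say that $x$ lies on the boundary if $x_i = 1$ or $x_i = m_i$ for some $i$. Let $\lambda : [m_1] \times \dots \times [m_N] \to \{-1, +1\}^N$ be a labelling that satisfies antipodality, i.e. $\lambda(\overline{x}) = -\lambda(x)$ for every point $x$ on the boundary of the grid. Then there exist $N$ (not necessarily distinct) grid points $z_1, \dots, z_N$ that cover all labels, i.e. for every $i \in [N]$ and every $v \in \{-1, +1\}$ there is $j \in [N]$ with $[\lambda(z_j)]_i = v$, and such that $\|z_j - z_k\|_\infty \le 1$ for all $j, k \in [N]$. -/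

import Mathlib

namespace StrongTucker

/-- The grid `[m 0] × ⋯ × [m (N-1)]`, where `[k] = {1, …, k}`. -/
abbrev Grid {N : ℕ} (m : Fin N → ℕ) : Type :=
  ∀ i : Fin N, Set.Icc 1 (m i)

/-- `x` lies on the boundary of the grid: some coordinate is extreme. -/
def OnBoundary {N : ℕ} {m : Fin N → ℕ} (x : Grid m) : Prop :=
  ∃ i, (x i : ℕ) = 1 ∨ (x i : ℕ) = m i

/-- The point `(m i - x i + 1)ᵢ`. (No truncation occurs, as `x i ≤ m i`.) -/
def antipode {N : ℕ} {m : Fin N → ℕ} (x : Grid m) : Grid m := fun i =>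
  ⟨m i - (x i : ℕ) + 1, by
    have h : 1 ≤ (x i : ℕ) ∧ (x i : ℕ) ≤ m i := (x i).2
    exact Set.mem_Icc.mpr ⟨by omega, by omega⟩⟩

/-- A labelling of the grid satisfies antipodality if antipodal boundary points have
opposite labels. -/
def IsAntipodal {N : ℕ} {m : Fin N → ℕ} {L : Type*} [Neg L] (label : Grid m → L) : Prop :=
  ∀ x : Grid m, OnBoundary x → label (antipode x) = -label x

/-- The points `z j` cover all labels: every value in `{-1, +1} = ℤˣ` occurs in every
label coordinate. -/
def CoversAllLabels {N : ℕ} {m : Fin N → ℕ} {J : Type*} (label : Grid m → Fin N → ℤˣ)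
    (z : J → Grid m) : Prop :=
  ∀ (i : Fin N) (v : ℤˣ), ∃ j, label (z j) i = v

/-- A grid point as a vector of `Fin N → ℝ`, whose norm is the sup norm. -/
def toVec {N : ℕ} {m : Fin N → ℕ} (x : Grid m) : Fin N → ℝ := fun i => ((x i : ℕ) : ℝ)

end StrongTucker

namespace StrongTucker

open Function

/-! Each label coordinate is read as a function `g i` into `ZMod 2`. It suffices to find a unit cube
on which no `g i` is constant: a minimal covering subset of its vertices has at most `N` points
(`exists_covering_family`).

Such a cube exists by parity. The cup product of the coboundaries δg vanishes on a cube where some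
`g i` is constant (`exists_ne_of_cupCoboundary_ne_zero`), yet its sum over the box is 1
(`boxSum_cupCoboundary`). Since the product X of the later factors is a cocycle, multiplying it by
δg gives δ(gX).

The sum is computed by induction on the dimension. Put Y = gX and let Y' be its pullback under
negation. The sum of δY over the box is the sum of δ(Y + Y') over one half. On the boundary Y' = Y +
X, so W = Y + Y' + X vanishes there, and δW = δ(Y + Y'). By Stokes only the central hyperplane
contributes; there Y and Y' have equal sums, and X gives the same statement one dimension lower.

For this hyperplane to consist of lattice points, the grid is doubled and centred at 0, and labels
are pulled back along a rounding that is odd away from 0. A side of length 1 would put 0 on the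
boundary and is handled separately. -/

/-! ### Selecting few points from a covering set -/

/-- A finite set covering all labels contains `N ≥ 2` points (with repetition) that do. -/
theorem exists_covering_family {α : Type*} {N : ℕ} (hN : 2 ≤ N) (label : α → Fin N → ℤˣ)
    (S : Finset α) (hS : ∀ i v, ∃ x ∈ S, label x i = v) :
    ∃ z : Fin N → α, (∀ j, z j ∈ S) ∧ ∀ i v, ∃ j, label (z j) i = v := by
  classical
  induction S using Finset.strongInduction with
  | H S ih =>
  by_cases hmin : ∃ x ∈ S, ∀ i v, ∃ y ∈ S.erase x, label y i = v
  · obtain ⟨x, hx, h⟩ := hmin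
    obtain ⟨z, hz, h⟩ := ih (S.erase x) (Finset.erase_ssubset hx) h
    exact ⟨z, fun j => Finset.mem_of_mem_erase (hz j), h⟩
  · push Not at hmin
    have : Nonempty (Fin N) := ⟨⟨0, by omega⟩⟩
    -- By minimality, no other point of `S` shows the value `v x` in coordinate `c x`.
    choose! c v hcv using hmin
    have hself : ∀ x ∈ S, label x (c x) = v x := by
      intro x hx
      obtain ⟨y, hy, h⟩ := hS (c x) (v x)
      by_cases hyx : y = x
      · rw [← hyx] at h ⊢; rw [hyx] at h ⊢; exact h
      · exact absurd h (hcv x hx y (Finset.mem_erase.2 ⟨hyx, hy⟩))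
    have hcard : S.card ≤ N := by
      by_cases hinj : Set.InjOn c (S : Set α)
      · simpa using Finset.card_le_card_of_injOn c (fun x _ => Finset.mem_univ (c x)) hinj
      · simp only [Set.InjOn, not_forall] at hinj
        obtain ⟨x, hx, y, hy, hc, hxy⟩ := hinj
        -- In the shared coordinate `x` and `y` carry opposite signs, so a third point would repeat
        -- one of them.
        have hsub : S ⊆ {x, y} := by
          intro w hw
          by_contra hne
          simp only [Finset.mem_insert, Finset.mem_singleton, not_or] at hne
          have h1 := hcv x hx w (Finset.mem_erase.2 ⟨hne.1, hw⟩)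
          have h2 := hcv y hy w (Finset.mem_erase.2 ⟨hne.2, hw⟩)
          have h3 := hcv x hx y (Finset.mem_erase.2 ⟨Ne.symm hxy, hy⟩)
          have h4 := hself y hy
          rw [← hc] at h2 h4
          rcases Int.units_eq_one_or (label w (c x)) with e1 | e1 <;>
          rcases Int.units_eq_one_or (v x) with e2 | e2 <;>
          rcases Int.units_eq_one_or (v y) with e3 | e3 <;> simp_all
        exact (Finset.card_le_card hsub).trans (Finset.card_le_two.trans hN)
    obtain ⟨x₀, hx₀, -⟩ := hS ⟨0, by omega⟩ 1
    have : Nonempty S := ⟨⟨x₀, hx₀⟩⟩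
    have hle : Fintype.card S ≤ Fintype.card (Fin N) := by simpa using hcard
    obtain ⟨f⟩ := Function.Embedding.nonempty_of_card_le hle
    refine ⟨fun j => (invFun f j : S), fun j => (invFun f j).2, fun i w => ?_⟩
    obtain ⟨x, hx, h⟩ := hS i w
    refine ⟨f ⟨x, hx⟩, ?_⟩
    simpa only [leftInverse_invFun f.injective _] using h

/-! ### Cubical cochains modulo two -/

section Cochains

variable {ι : Type*} [DecidableEq ι]

/-- A cubical cochain with values in `ZMod 2`: a function of the set of directions of a cube
with one corner `a` and the opposite corner given by `b` in these directions. -/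
abbrev Cochain (ι : Type*) : Type _ := Finset ι → (ι → ℤ) → (ι → ℤ) → ZMod 2

/-- The coboundary of a cochain. -/
def coboundary (W : Cochain ι) : Cochain ι := fun A a b =>
  ∑ i ∈ A, (W (A.erase i) a b + W (A.erase i) (update a i (b i)) b)

/-- The value on a cube only depends on `b` through the directions of the cube. -/
def IsLocal (W : Cochain ι) : Prop :=
  ∀ A a b i c, i ∉ A → W A a (update b i c) = W A a b

/-- The cup product of the coboundaries of the functions in a list. -/
def cupCoboundary : List ((ι → ℤ) → ZMod 2) → Cochain ι
  | [] => fun _ _ _ => 1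
  | g :: gs => coboundary fun A a b => g a * cupCoboundary gs A a b

/-- The ordered pairs (i, j) and (j, i) of removed directions contribute the same four terms, which
cancel modulo 2. -/
theorem coboundary_coboundary (W : Cochain ι) (A : Finset ι) (a b : ι → ℤ) :
    coboundary (coboundary W) A a b = 0 := by
  have h : coboundary (coboundary W) A a b = ∑ x ∈ A.offDiag,
      (W ((A.erase x.1).erase x.2) a b + W ((A.erase x.1).erase x.2) (update a x.2 (b x.2)) b +
       (W ((A.erase x.1).erase x.2) (update a x.1 (b x.1)) b +
        W ((A.erase x.1).erase x.2) (update (update a x.1 (b x.1)) x.2 (b x.2)) b)) := by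
    simp only [coboundary, ← Finset.sum_add_distrib]
    rw [Finset.sum_sigma']
    refine Finset.sum_bij' (fun x _ => (x.1, x.2)) (fun x _ => ⟨x.1, x.2⟩) ?_ ?_ ?_ ?_ ?_
    · rintro ⟨i, j⟩ h
      simp only [Finset.mem_sigma, Finset.mem_erase, Finset.mem_offDiag] at h ⊢
      exact ⟨h.1, h.2.2, Ne.symm h.2.1⟩
    · rintro ⟨i, j⟩ h
      simp only [Finset.mem_sigma, Finset.mem_erase, Finset.mem_offDiag] at h ⊢
      exact ⟨h.1, Ne.symm h.2.2, h.2.1⟩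
    · intros; rfl
    · intros; rfl
    · intros; rfl
  rw [h]
  refine Finset.sum_involution (fun x _ => x.swap) ?_ ?_ ?_ ?_
  · rintro ⟨i, j⟩ h
    simp only [Finset.mem_offDiag] at h
    simp only [Prod.fst_swap, Prod.snd_swap, Finset.erase_right_comm (a := j) (b := i),
      update_comm h.2.2]
    generalize W _ a b = p
    generalize W _ (update a j (b j)) b = q
    generalize W _ (update a i (b i)) b = r
    generalize W _ _ b = s
    revert p q r s
    decide
  · rintro ⟨i, j⟩ h _ he
    simp only [Finset.mem_offDiag] at h
    simp only [Prod.swap_prod_mk, Prod.mk.injEq] at he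
    exact h.2.2 he.2
  · rintro ⟨i, j⟩ h
    simp only [Finset.mem_offDiag, Prod.swap_prod_mk] at h ⊢
    exact ⟨h.2.1, h.1, Ne.symm h.2.2⟩
  · intros; simp

theorem coboundary_cupCoboundary (gs : List ((ι → ℤ) → ZMod 2)) (A : Finset ι) (a b : ι → ℤ) :
    coboundary (cupCoboundary gs) A a b = 0 := by
  cases gs with
  | nil => exact Finset.sum_eq_zero fun _ _ => by simp only [cupCoboundary]; decide
  | cons g gs => exact coboundary_coboundary _ A a b

theorem IsLocal.coboundary {W : Cochain ι} (hW : IsLocal W) : IsLocal (coboundary W) := by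
  intro A a b i c hi
  refine Finset.sum_congr rfl fun j hj => ?_
  have hij : j ≠ i := fun h => hi (h ▸ hj)
  have hi' : i ∉ A.erase j := fun h => hi (Finset.mem_of_mem_erase h)
  rw [update_of_ne hij, hW _ _ _ _ _ hi', hW _ _ _ _ _ hi']

theorem isLocal_cupCoboundary (gs : List ((ι → ℤ) → ZMod 2)) : IsLocal (cupCoboundary gs) := by
  induction gs with
  | nil => intro A a b i c _; rfl
  | cons g gs ih =>
    refine IsLocal.coboundary fun A a b i c hi => ?_
    rw [ih A a b i c hi]

/-- If the cup product does not vanish on a cube, no function is constant on it. -/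
theorem exists_ne_of_cupCoboundary_ne_zero (gs : List ((ι → ℤ) → ZMod 2)) :
    ∀ (A : Finset ι) (a b : ι → ℤ), cupCoboundary gs A a b ≠ 0 → ∀ g ∈ gs,
      ∃ p q : ι → ℤ, (∀ j, p j = a j ∨ p j = b j) ∧ (∀ j, q j = a j ∨ q j = b j) ∧ g p ≠ g q := by
  induction gs with
  | nil => simp
  | cons f gs ih =>
    intro A a b h g hg
    have hupd : ∀ i : ι, ∀ p : ι → ℤ, (∀ j, p j = update a i (b i) j ∨ p j = b j) →
        ∀ j, p j = a j ∨ p j = b j := by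
      intro i p hp j
      rcases hp j with h | h
      · by_cases hji : j = i
        · subst hji; rw [update_self] at h; exact Or.inr h
        · rw [update_of_ne hji] at h; exact Or.inl h
      · exact Or.inr h
    rcases List.mem_cons.1 hg with rfl | hg
    · by_contra hcon
      push Not at hcon
      apply h
      -- A function constant on the cube factors out, leaving the coboundary of a cocycle.
      have hs : cupCoboundary (g :: gs) A a b = g a * coboundary (cupCoboundary gs) A a b := by
        simp only [cupCoboundary, coboundary, Finset.mul_sum, mul_add]
        refine Finset.sum_congr rfl fun i _ => ?_
        rw [hcon (update a i (b i)) a (hupd i _ fun j => Or.inl rfl) fun j => Or.inl rfl]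
      rw [hs, coboundary_cupCoboundary, mul_zero]
    · obtain ⟨i, -, hi⟩ := Finset.exists_ne_zero_of_sum_ne_zero h
      by_cases h0 : cupCoboundary gs (A.erase i) a b = 0
      · have h1 : cupCoboundary gs (A.erase i) (update a i (b i)) b ≠ 0 := by
          intro h1
          simp only [h0, h1, mul_zero, add_zero] at hi
          exact hi rfl
        obtain ⟨p, q, hp, hq, hpq⟩ := ih _ _ _ h1 g hg
        exact ⟨p, q, hupd i p hp, hupd i q hq, hpq⟩
      · exact ih _ _ _ h0 g hg

/-! ### Summation over the cubes of a box -/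

variable (k : ι → ℕ)

/-- The cube spanned by `a` and `b` is a unit cube in the box with half side lengths `k`. -/
def InBox (a b : ι → ℤ) : Prop :=
  ∀ j, |a j| ≤ k j ∧ |b j| ≤ k j ∧ |a j - b j| ≤ 1

/-- Sum over the edges from `s * t` to `s * (t + 1)`, `t < k i`, in direction `i`. -/
def raySum (i : ι) (s : ℤ) (F : (ι → ℤ) → (ι → ℤ) → ZMod 2) (a b : ι → ℤ) : ZMod 2 :=
  ∑ t ∈ Finset.range (k i), F (update a i (s * t)) (update b i (s * (t + 1)))

/-- Sum over all edges of the box in direction `i`, oriented away from the centre. -/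
def lineSum (i : ι) (F : (ι → ℤ) → (ι → ℤ) → ZMod 2) (a b : ι → ℤ) : ZMod 2 :=
  raySum k i 1 F a b + raySum k i (-1) F a b

/-- Sum over all cubes of the box with the given list of directions. -/
def boxSum : List ι → ((ι → ℤ) → (ι → ℤ) → ZMod 2) → (ι → ℤ) → (ι → ℤ) → ZMod 2
  | [], F => F
  | i :: l, F => lineSum k i (boxSum l F)

variable {k}

theorem InBox.update {a b : ι → ℤ} (h : InBox k a b) (i : ι) {u v : ℤ} (hu : |u| ≤ k i)
    (hv : |v| ≤ k i) (huv : |u - v| ≤ 1) : InBox k (update a i u) (update b i v) := by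
  intro j
  by_cases hj : j = i
  · subst hj; simp only [update_self]; exact ⟨hu, hv, huv⟩
  · simp only [update_of_ne hj]; exact h j

theorem InBox.update_left {a b : ι → ℤ} (h : InBox k a b) (i : ι) :
    InBox k (Function.update a i (b i)) b := by
  have := h.update i (h i).2.1 (h i).2.1 (by simp)
  rwa [update_eq_self] at this

omit [DecidableEq ι] in
theorem inBox_zero : InBox k 0 0 := fun j => by simp

theorem InBox.ray {a b : ι → ℤ} (h : InBox k a b) (i : ι) {s : ℤ} (hs : s = 1 ∨ s = -1) {t : ℕ}
    (ht : t < k i) :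
    InBox k (Function.update a i (s * t)) (Function.update b i (s * (t + 1))) := by
  apply h.update
  · rcases hs with rfl | rfl <;> rw [abs_le] <;> constructor <;> omega
  · rcases hs with rfl | rfl <;> rw [abs_le] <;> constructor <;> omega
  · rcases hs with rfl | rfl <;> rw [abs_le] <;> constructor <;> omega

theorem raySum_congr {F G : (ι → ℤ) → (ι → ℤ) → ZMod 2} (hFG : ∀ a b, InBox k a b → F a b = G a b)
    (i : ι) {s : ℤ} (hs : s = 1 ∨ s = -1) (a b : ι → ℤ) (h : InBox k a b) :
    raySum k i s F a b = raySum k i s G a b :=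
  Finset.sum_congr rfl fun _ ht => hFG _ _ (h.ray i hs (Finset.mem_range.1 ht))

theorem lineSum_congr {F G : (ι → ℤ) → (ι → ℤ) → ZMod 2}
    (hFG : ∀ a b, InBox k a b → F a b = G a b) (i : ι) (a b : ι → ℤ) (h : InBox k a b) :
    lineSum k i F a b = lineSum k i G a b := by
  rw [lineSum, lineSum, raySum_congr hFG i (Or.inl rfl) a b h, raySum_congr hFG i (Or.inr rfl) a b h]

theorem boxSum_congr {F G : (ι → ℤ) → (ι → ℤ) → ZMod 2}
    (hFG : ∀ a b, InBox k a b → F a b = G a b) (l : List ι) :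
    ∀ a b : ι → ℤ, InBox k a b → boxSum k l F a b = boxSum k l G a b := by
  induction l with
  | nil => exact hFG
  | cons i l ih => exact lineSum_congr ih i

theorem raySum_zero (i : ι) (s : ℤ) (a b : ι → ℤ) : raySum k i s (fun _ _ => 0) a b = 0 :=
  Finset.sum_const_zero

theorem lineSum_zero (i : ι) (a b : ι → ℤ) : lineSum k i (fun _ _ => 0) a b = 0 := by
  simp [lineSum, raySum_zero]

theorem boxSum_zero (l : List ι) (a b : ι → ℤ) : boxSum k l (fun _ _ => 0) a b = 0 := by
  induction l generalizing a b with
  | nil => rfl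
  | cons i l ih =>
    have : boxSum k l (fun _ _ => 0) = fun _ _ => 0 := by funext a b; exact ih a b
    rw [boxSum, this, lineSum_zero]

theorem raySum_add (i : ι) (s : ℤ) (F G : (ι → ℤ) → (ι → ℤ) → ZMod 2) (a b : ι → ℤ) :
    raySum k i s (fun a b => F a b + G a b) a b = raySum k i s F a b + raySum k i s G a b :=
  Finset.sum_add_distrib

theorem lineSum_add (i : ι) (F G : (ι → ℤ) → (ι → ℤ) → ZMod 2) (a b : ι → ℤ) :
    lineSum k i (fun a b => F a b + G a b) a b = lineSum k i F a b + lineSum k i G a b := by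
  simp only [lineSum, raySum_add]; ring

theorem boxSum_add (l : List ι) (F G : (ι → ℤ) → (ι → ℤ) → ZMod 2) (a b : ι → ℤ) :
    boxSum k l (fun a b => F a b + G a b) a b = boxSum k l F a b + boxSum k l G a b := by
  induction l generalizing a b with
  | nil => rfl
  | cons i l ih =>
    have : boxSum k l (fun a b => F a b + G a b) = fun a b => boxSum k l F a b + boxSum k l G a b := by
      funext a b; exact ih a b
    rw [boxSum, this, lineSum_add]; rfl

theorem boxSum_sum {κ : Type*} (l : List ι) (A : Finset κ)
    (F : κ → (ι → ℤ) → (ι → ℤ) → ZMod 2) (a b : ι → ℤ) :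
    boxSum k l (fun a b => ∑ i ∈ A, F i a b) a b = ∑ i ∈ A, boxSum k l (F i) a b := by
  classical
  induction A using Finset.induction_on with
  | empty => simp only [Finset.sum_empty, boxSum_zero]
  | insert i A hi ih => simp only [Finset.sum_insert hi, boxSum_add, ih]

theorem raySum_comm {i j : ι} (hij : i ≠ j) (s r : ℤ) (F : (ι → ℤ) → (ι → ℤ) → ZMod 2) :
    raySum k i s (raySum k j r F) = raySum k j r (raySum k i s F) := by
  funext a b
  simp only [raySum]
  rw [Finset.sum_comm]
  simp only [update_comm hij]

theorem raySum_lineSum_comm {i j : ι} (hij : i ≠ j) (s : ℤ) (F : (ι → ℤ) → (ι → ℤ) → ZMod 2) :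
    raySum k i s (lineSum k j F) = lineSum k j (raySum k i s F) := by
  funext a b
  have : lineSum k j F = fun a b => raySum k j 1 F a b + raySum k j (-1) F a b := rfl
  rw [this, raySum_add, raySum_comm hij, raySum_comm hij]
  rfl

theorem raySum_boxSum_comm {i : ι} {l : List ι} (hi : i ∉ l) (s : ℤ)
    (F : (ι → ℤ) → (ι → ℤ) → ZMod 2) :
    raySum k i s (boxSum k l F) = boxSum k l (raySum k i s F) := by
  induction l with
  | nil => rfl
  | cons j l ih =>
    simp only [List.mem_cons, not_or] at hi
    rw [boxSum, raySum_lineSum_comm hi.1, ih hi.2, boxSum]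

theorem lineSum_boxSum_comm {i : ι} {l : List ι} (hi : i ∉ l)
    (F : (ι → ℤ) → (ι → ℤ) → ZMod 2) :
    lineSum k i (boxSum k l F) = boxSum k l (lineSum k i F) := by
  funext a b
  rw [lineSum, raySum_boxSum_comm hi, raySum_boxSum_comm hi, ← boxSum_add]
  rfl

/-- Sums in distinct directions commute, so direction `i` can be summed innermost. -/
theorem boxSum_eq_zero {i : ι} {F : (ι → ℤ) → (ι → ℤ) → ZMod 2}
    (hF : ∀ a b, InBox k a b → lineSum k i F a b = 0) (l : List ι) (hl : l.Nodup) (hi : i ∈ l) :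
    ∀ a b, InBox k a b → boxSum k l F a b = 0 := by
  induction l with
  | nil => simp at hi
  | cons j l ih =>
    intro a b hab
    rw [List.nodup_cons] at hl
    rcases List.mem_cons.1 hi with rfl | hi
    · rw [boxSum, lineSum_boxSum_comm hl.1, boxSum_congr hF l a b hab, boxSum_zero]
    · rw [boxSum, lineSum_congr (ih hl.2 hi) j a b hab, lineSum_zero]

theorem neg_update (a : ι → ℤ) (i : ι) (c : ℤ) : -update a i c = update (-a) i (-c) := by
  funext j
  by_cases hj : j = i
  · subst hj; simp
  · simp [update_of_ne hj]

theorem raySum_neg (i : ι) (s : ℤ) (F : (ι → ℤ) → (ι → ℤ) → ZMod 2) (a b : ι → ℤ) :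
    raySum k i s (fun a b => F (-a) (-b)) a b = raySum k i (-s) F (-a) (-b) := by
  simp only [raySum, neg_update, neg_mul]

theorem lineSum_neg (i : ι) (F : (ι → ℤ) → (ι → ℤ) → ZMod 2) (a b : ι → ℤ) :
    lineSum k i (fun a b => F (-a) (-b)) a b = lineSum k i F (-a) (-b) := by
  simp only [lineSum, raySum_neg, neg_neg, add_comm]

theorem boxSum_neg (l : List ι) (F : (ι → ℤ) → (ι → ℤ) → ZMod 2) (a b : ι → ℤ) :
    boxSum k l (fun a b => F (-a) (-b)) a b = boxSum k l F (-a) (-b) := by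
  induction l generalizing a b with
  | nil => rfl
  | cons i l ih =>
    have : boxSum k l (fun a b => F (-a) (-b)) = fun a b => boxSum k l F (-a) (-b) := by
      funext a b; exact ih a b
    rw [boxSum, this, lineSum_neg]; rfl

theorem exists_ne_zero_of_boxSum_ne_zero {l : List ι} {F : (ι → ℤ) → (ι → ℤ) → ZMod 2}
    {a b : ι → ℤ} (hab : InBox k a b) (h : boxSum k l F a b ≠ 0) :
    ∃ a b, InBox k a b ∧ F a b ≠ 0 := by
  by_contra hcon
  push Not at hcon
  exact h ((boxSum_congr hcon l a b hab).trans (boxSum_zero l a b))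

theorem boxSum_update_eq {n : ι} {l : List ι} (hn : n ∉ l)
    (F : (ι → ℤ) → (ι → ℤ) → ZMod 2) (a b : ι → ℤ) (ha : a n = 0) :
    boxSum k l (fun a b => F (update a n 0) b) a b = boxSum k l F a b := by
  induction l generalizing a b with
  | nil => simp only [boxSum]; rw [← ha, update_eq_self]
  | cons i l ih =>
    simp only [List.mem_cons, not_or] at hn
    simp only [boxSum, lineSum, raySum]
    congr 1 <;> exact Finset.sum_congr rfl fun t _ =>
      ih hn.2 _ _ (by rw [update_of_ne hn.1, ha])

/-! ### Stokes' theorem on half of the box -/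

theorem raySum_telescope {W : Cochain ι} (hW : IsLocal W) {A : Finset ι} {i : ι} (hi : i ∉ A)
    (s : ℤ) (a b : ι → ℤ) :
    raySum k i s (fun a b => W A a b + W A (update a i (b i)) b) a b =
      W A (update a i 0) b + W A (update a i (s * k i)) b := by
  simp only [raySum, update_self, update_idem, hW A _ _ i _ hi]
  induction k i with
  | zero => simp [CharTwo.add_self_eq_zero]
  | succ n ih =>
    rw [Finset.sum_range_succ, ih]
    push_cast
    generalize W A (update a i 0) b = p
    generalize W A (update a i (s * n)) b = q
    generalize W A _ b = r
    revert p q r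
    decide

/-- Both rays start at the centre, whose term occurs twice and cancels. -/
theorem lineSum_telescope {W : Cochain ι} (hW : IsLocal W) {A : Finset ι} {i : ι} (hi : i ∉ A)
    (a b : ι → ℤ) :
    lineSum k i (fun a b => W A a b + W A (update a i (b i)) b) a b =
      W A (update a i (k i)) b + W A (update a i (-k i)) b := by
  rw [lineSum, raySum_telescope hW hi, raySum_telescope hW hi, one_mul, neg_one_mul]
  generalize W A (update a i 0) b = p
  generalize W A (update a i (k i)) b = q
  generalize W A _ b = r
  revert p q r
  decide

/-- The cochain vanishes on the cubes in the boundary of the box. -/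
def VanishesOnBoundary (k : ι → ℕ) (W : Cochain ι) : Prop :=
  ∀ A a b i, InBox k a b → i ∉ A → |a i| = k i → W A a b = 0

theorem VanishesOnBoundary.update_eq_zero {W : Cochain ι} (hb : VanishesOnBoundary k W)
    (hW : IsLocal W) {A : Finset ι} {i : ι} (hi : i ∉ A) {a b : ι → ℤ} (hab : InBox k a b)
    {c : ℤ} (hc : |c| = k i) : W A (update a i c) b = 0 := by
  rw [← hW A _ b i c hi]
  exact hb A _ _ i (hab.update i hc.le hc.le (by simp)) hi (by rw [update_self, hc])

theorem raySum_boxSum_coboundary {W : Cochain ι} (hW : IsLocal W) (hb : VanishesOnBoundary k W)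
    {n : ι} {l : List ι} (hn : n ∉ l) (hl : l.Nodup) :
    raySum k n 1 (boxSum k l (coboundary W (insert n l.toFinset))) 0 0 =
      boxSum k l (fun a b => W l.toFinset (update a n 0) b) 0 0 := by
  have hn' : n ∉ l.toFinset := by simpa using hn
  rw [raySum_boxSum_comm hn]
  have hsplit : coboundary W (insert n l.toFinset) = fun a b =>
      (W l.toFinset a b + W l.toFinset (update a n (b n)) b) +
      ∑ i ∈ l.toFinset, (W ((insert n l.toFinset).erase i) a b +
        W ((insert n l.toFinset).erase i) (update a i (b i)) b) := by
    funext a b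
    rw [coboundary, Finset.sum_insert hn', Finset.erase_insert hn']
  have hadd : raySum k n 1 (coboundary W (insert n l.toFinset)) = fun a b =>
      raySum k n 1 (fun a b => W l.toFinset a b + W l.toFinset (update a n (b n)) b) a b +
      raySum k n 1 (fun a b => ∑ i ∈ l.toFinset, (W ((insert n l.toFinset).erase i) a b +
        W ((insert n l.toFinset).erase i) (update a i (b i)) b)) a b := by
    funext a b
    rw [hsplit, raySum_add]
  rw [hadd, boxSum_add, ← raySum_boxSum_comm hn]
  -- In the directions of `l` the sum runs over whole lines, so it telescopes to boundary faces,
  -- where `W` vanishes.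
  have hrest : raySum k n 1 (boxSum k l (fun a b =>
      ∑ i ∈ l.toFinset, (W ((insert n l.toFinset).erase i) a b +
        W ((insert n l.toFinset).erase i) (update a i (b i)) b))) 0 0 = 0 := by
    rw [raySum_congr (G := fun _ _ => 0) _ n (Or.inl rfl) 0 0 inBox_zero, raySum_zero]
    intro a b hab
    rw [boxSum_sum]
    refine Finset.sum_eq_zero fun i hi => ?_
    refine boxSum_eq_zero (i := i) (fun a b hab => ?_) l hl (by simpa using hi) a b hab
    have hi' : i ∉ (insert n l.toFinset).erase i := Finset.notMem_erase i _
    rw [lineSum_telescope hW hi', hb.update_eq_zero hW hi' hab (by simp),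
      hb.update_eq_zero hW hi' hab (by simp), add_zero]
  rw [raySum_boxSum_comm hn] at hrest ⊢
  rw [hrest, add_zero]
  refine boxSum_congr (fun a b hab => ?_) l 0 0 inBox_zero
  rw [raySum_telescope hW hn', hb.update_eq_zero hW hn' hab (c := 1 * k n) (by simp), add_zero]

/-! ### The parity of the number of fully labelled cubes -/

/-- The function takes opposite values at antipodal points of the boundary of the box. -/
def AntipodalOnBoundary (k : ι → ℕ) (g : (ι → ℤ) → ZMod 2) : Prop :=
  ∀ a : ι → ℤ, (∀ j, |a j| ≤ k j) → (∃ i, |a i| = k i) → g (-a) = g a + 1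

theorem coboundary_neg (W : Cochain ι) (A : Finset ι) (a b : ι → ℤ) :
    coboundary W A (-a) (-b) = coboundary (fun A a b => W A (-a) (-b)) A a b := by
  simp only [coboundary, neg_update, Pi.neg_apply]

theorem coboundary_congr {W V : Cochain ι} {i : ι}
    (h : ∀ A a b, InBox k a b → i ∉ A → |a i| = k i → W A a b = V A a b)
    {A : Finset ι} {a b : ι → ℤ} (hab : InBox k a b) (hi : i ∉ A) (hai : |a i| = k i) :
    coboundary W A a b = coboundary V A a b := by
  refine Finset.sum_congr rfl fun j hj => ?_
  have hij : i ≠ j := fun h => hi (h ▸ hj)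
  have hi' : i ∉ A.erase j := fun h => hi (Finset.mem_of_mem_erase h)
  rw [h _ a b hab hi' hai, h _ _ b (hab.update_left j) hi' (by rwa [update_of_ne hij])]

theorem coboundary_add (W V : Cochain ι) (A : Finset ι) (a b : ι → ℤ) :
    coboundary (fun A a b => W A a b + V A a b) A a b = coboundary W A a b + coboundary V A a b := by
  simp only [coboundary, ← Finset.sum_add_distrib]
  exact Finset.sum_congr rfl fun _ _ => by ring

/-- On the boundary, negation adds 1 to `g`, so it changes the cochain under the coboundary by a
cocycle only. -/
theorem cupCoboundary_neg {gs : List ((ι → ℤ) → ZMod 2)}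
    (hgs : ∀ g ∈ gs, AntipodalOnBoundary k g) (i : ι) :
    ∀ (A : Finset ι) (a b : ι → ℤ), InBox k a b → i ∉ A → |a i| = k i →
      cupCoboundary gs A (-a) (-b) = cupCoboundary gs A a b := by
  induction gs with
  | nil => intros; rfl
  | cons g gs ih =>
    intro A a b hab hi hai
    have ih := ih fun f hf => hgs f (List.mem_cons_of_mem g hf)
    rw [cupCoboundary, coboundary_neg, coboundary_congr
      (V := fun A a b => g a * cupCoboundary gs A a b + cupCoboundary gs A a b) _ hab hi hai,
      coboundary_add, coboundary_cupCoboundary, add_zero]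
    intro A a b hab hi hai
    rw [ih A a b hab hi hai, hgs g List.mem_cons_self a (fun j => (hab j).1) ⟨i, hai⟩]
    ring

/-- The cup product of the coboundaries of `N` antipodal functions sums to `1` over an
`N`-dimensional box. -/
theorem boxSum_cupCoboundary (l : List ι) (hl : l.Nodup) (gs : List ((ι → ℤ) → ZMod 2))
    (hlen : gs.length = l.length) (hgs : ∀ g ∈ gs, AntipodalOnBoundary k g) :
    boxSum k l (cupCoboundary gs l.toFinset) 0 0 = 1 := by
  induction l generalizing gs with
  | nil =>
    rw [List.length_nil, List.length_eq_zero_iff] at hlen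
    subst hlen
    rfl
  | cons n l ih =>
    match gs, hlen with
    | g :: gs, hlen =>
    rw [List.nodup_cons] at hl
    have hgs' : ∀ f ∈ gs, AntipodalOnBoundary k f := fun f hf => hgs f (List.mem_cons_of_mem g hf)
    have ih := ih hl.2 gs (by simpa using hlen) hgs'
    set X := cupCoboundary gs with hX
    set Y : Cochain ι := fun A a b => g a * X A a b with hY
    set Y' : Cochain ι := fun A a b => Y A (-a) (-b) with hY'
    set W : Cochain ι := fun A a b => (Y A a b + Y' A a b) + X A a b with hW
    have hXloc : IsLocal X := isLocal_cupCoboundary gs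
    have hWloc : IsLocal W := by
      intro A a b i c hi
      simp only [hW, hY', hY, neg_update, hXloc A _ _ i _ hi]
    have hWb : VanishesOnBoundary k W := by
      intro A a b i hab hi hai
      simp only [hW, hY', hY]
      rw [hX, cupCoboundary_neg hgs' i A a b hab hi hai,
        hgs g List.mem_cons_self a (fun j => (hab j).1) ⟨i, hai⟩]
      generalize g a = p
      generalize cupCoboundary gs A a b = q
      revert p q
      decide
    have hstokes := raySum_boxSum_coboundary hWloc hWb hl.1 hl.2
    have hleft : coboundary W (insert n l.toFinset) = fun a b =>
        coboundary Y (insert n l.toFinset) a b +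
          coboundary Y (insert n l.toFinset) (-a) (-b) := by
      funext a b
      rw [hW, coboundary_add, coboundary_add, hX, coboundary_cupCoboundary, add_zero,
        coboundary_neg]
    -- Negation swaps the two halves of the box and respects the orientation away from the centre.
    have hray : ∀ F : (ι → ℤ) → (ι → ℤ) → ZMod 2,
        raySum k n 1 (boxSum k l fun a b => F a b + F (-a) (-b)) 0 0 =
          boxSum k (n :: l) F 0 0 := by
      intro F
      rw [show (boxSum k l fun a b => F a b + F (-a) (-b)) =
          fun a b => boxSum k l F a b + boxSum k l F (-a) (-b) by
        funext a b
        rw [boxSum_add l F fun a b => F (-a) (-b), boxSum_neg], raySum_add, raySum_neg, neg_zero]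
      rfl
    rw [hleft, hray] at hstokes
    rw [List.toFinset_cons, cupCoboundary, hstokes, ← ih]
    have hright : ∀ a b : ι → ℤ, W l.toFinset (update a n 0) b =
        (Y l.toFinset (update a n 0) b + Y l.toFinset (update (-a) n 0) (-b)) +
          X l.toFinset (update a n 0) b := by
      intro a b
      simp only [hW, hY', neg_update, neg_zero]
    -- The central hyperplane is invariant under negation, so the two `Y` terms have equal sums.
    have hsum : boxSum k l (fun a b => W l.toFinset (update a n 0) b) 0 0 =
        boxSum k l (fun a b => X l.toFinset (update a n 0) b) 0 0 := by
      rw [show (fun a b => W l.toFinset (update a n 0) b) = _ from funext₂ hright, boxSum_add,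
        boxSum_add, boxSum_neg l (fun a b => Y l.toFinset (update a n 0) b), neg_zero,
        CharTwo.add_self_eq_zero, zero_add]
    rw [hsum]
    exact boxSum_update_eq hl.1 _ 0 0 rfl

end Cochains
theorem exists_cube_forall_ne {N : ℕ} {k : Fin N → ℕ} (g : Fin N → (Fin N → ℤ) → ZMod 2)
    (hg : ∀ i, AntipodalOnBoundary k (g i)) :
    ∃ a b : Fin N → ℤ, InBox k a b ∧ ∀ i, ∃ p q : Fin N → ℤ, (∀ j, p j = a j ∨ p j = b j) ∧
      (∀ j, q j = a j ∨ q j = b j) ∧ g i p ≠ g i q := by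
  have h := boxSum_cupCoboundary (List.finRange N) (List.nodup_finRange N) (List.ofFn g)
    (by simp) (by simpa [List.mem_ofFn] using hg)
  obtain ⟨a, b, hab, h⟩ := exists_ne_zero_of_boxSum_ne_zero inBox_zero (h.trans_ne one_ne_zero)
  exact ⟨a, b, hab, fun i => exists_ne_of_cupCoboundary_ne_zero _ _ a b h (g i) (by simp)⟩

/-! ### Rounding the doubled grid to the grid -/

section Rounding

variable {N : ℕ} {m : Fin N → ℕ}

open Classical in
/-- The offset that makes halving round up at lexicographically positive vectors, and down at
the others. -/
noncomputable def offset (y : Fin N → ℤ) : ℤ := if 0 < toLex y then 1 else 0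

theorem offset_nonneg (y : Fin N → ℤ) : 0 ≤ offset y := by
  unfold offset; split_ifs <;> simp

theorem offset_le_one (y : Fin N → ℤ) : offset y ≤ 1 := by
  unfold offset; split_ifs <;> simp

theorem offset_neg {y : Fin N → ℤ} (hy : y ≠ 0) : offset (-y) = 1 - offset y := by
  have h : toLex y ≠ 0 := hy
  have hneg : 0 < toLex (-y) ↔ toLex y < 0 := by rw [toLex_neg, Left.neg_pos_iff]
  unfold offset
  rcases lt_or_gt_of_ne h with h | h
  · have h' : ¬0 < toLex y := h.not_gt
    rw [if_pos (hneg.2 h), if_neg h']; rfl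
  · have h' : 0 < toLex y := h
    rw [if_neg (mt hneg.1 h.not_gt), if_pos h']; rfl

/-- The grid point nearest to `(y + m + 1) / 2`. -/
noncomputable def roundToGrid (hm : ∀ i, 1 ≤ m i) (y : Fin N → ℤ) : Grid m := fun i =>
  -- A grid point `x` corresponds to `y = 2x - m - 1`, so antipodes become negatives. The projection
  -- only serves to make the map total.
  Set.projIcc 1 (m i) (hm i) ((y i + m i + 1 + offset y) / 2).toNat

theorem coe_roundToGrid (hm : ∀ i, 1 ≤ m i) {y : Fin N → ℤ} {i : Fin N}
    (hy : |y i| ≤ (m i - 1 : ℕ)) :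
    ((roundToGrid hm y i : ℕ) : ℤ) = (y i + m i + 1 + offset y) / 2 := by
  have h0 := offset_nonneg y
  have h1 := offset_le_one y
  have hmi := hm i
  rw [abs_le] at hy
  have hmem : ((y i + m i + 1 + offset y) / 2).toNat ∈ Set.Icc 1 (m i) := by
    rw [Set.mem_Icc]; omega
  rw [roundToGrid, Set.projIcc_of_mem (hm i) hmem]
  dsimp only
  omega

theorem roundToGrid_neg (hm : ∀ i, 1 ≤ m i) {y : Fin N → ℤ} (hy : ∀ i, |y i| ≤ (m i - 1 : ℕ))
    (h0 : y ≠ 0) : roundToGrid hm (-y) = antipode (roundToGrid hm y) := by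
  funext i
  apply Subtype.ext
  have e1 := coe_roundToGrid hm (hy i)
  have e2 := coe_roundToGrid hm (y := -y) (i := i) (by simpa using hy i)
  rw [offset_neg h0, Pi.neg_apply] at e2
  have hle := (roundToGrid hm y i).2.2
  simp only [antipode]
  omega

/-- At an extreme value the sum `y i + m i + 1` is even, so the offset does not affect the quotient.
-/
theorem onBoundary_roundToGrid (hm : ∀ i, 1 ≤ m i) {y : Fin N → ℤ} {i : Fin N}
    (hy : |y i| = (m i - 1 : ℕ)) : OnBoundary (roundToGrid hm y) := by
  refine ⟨i, ?_⟩
  have e := coe_roundToGrid hm hy.le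
  have h0 := offset_nonneg y
  have h1 := offset_le_one y
  have hmi := hm i
  rcases abs_choice (y i) with h | h <;> rw [h] at hy <;> omega

theorem abs_roundToGrid_sub_le (hm : ∀ i, 1 ≤ m i) {p q : Fin N → ℤ} {i : Fin N}
    (hp : |p i| ≤ (m i - 1 : ℕ)) (hq : |q i| ≤ (m i - 1 : ℕ)) (hpq : |p i - q i| ≤ 1) :
    |((roundToGrid hm p i : ℕ) : ℤ) - (roundToGrid hm q i : ℕ)| ≤ 1 := by
  rw [coe_roundToGrid hm hp, coe_roundToGrid hm hq]
  have := offset_nonneg p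
  have := offset_le_one p
  have := offset_nonneg q
  have := offset_le_one q
  rw [abs_le] at hpq ⊢
  omega

end Rounding

/-- If some side of the grid is a point, a central point and its antipode have all labels. -/
theorem exists_covering_pair {N : ℕ} {m : Fin N → ℕ} (hm : ∀ i, 1 ≤ m i)
    (label : Grid m → Fin N → ℤˣ) (hlabel : IsAntipodal label) {i₀ : Fin N} (hi₀ : m i₀ = 1) :
    ∃ S : Finset (Grid m), (∀ i v, ∃ x ∈ S, label x i = v) ∧
      ∀ x ∈ S, ∀ y ∈ S, ∀ i, |((x i : ℕ) : ℤ) - (y i : ℕ)| ≤ 1 := by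
  classical
  -- A most central point differs from its antipode by at most 1 in each coordinate.
  let x : Grid m := fun i => ⟨(m i + 1) / 2, by
    have := hm i
    exact Set.mem_Icc.2 (by omega)⟩
  have hx : label (antipode x) = -label x := by
    refine hlabel x ⟨i₀, Or.inl ?_⟩
    simp only [x, hi₀]
  have hcoord : ∀ y ∈ ({x, antipode x} : Finset (Grid m)), ∀ i,
      ((y i : ℕ) : ℤ) = (m i + 1) / 2 ∨ ((y i : ℕ) : ℤ) = m i + 1 - (m i + 1) / 2 := by
    intro y hy i
    have := hm i
    rcases Finset.mem_insert.1 hy with rfl | hy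
    · left; simp [x]
    · rw [Finset.mem_singleton.1 hy]
      right; simp only [antipode, x]; omega
  refine ⟨{x, antipode x}, fun i v => ?_, fun y hy z hz i => ?_⟩
  · by_cases h : label x i = v
    · exact ⟨x, by simp, h⟩
    · refine ⟨antipode x, by simp, ?_⟩
      rw [hx, Pi.neg_apply, Int.units_ne_iff_eq_neg.1 h, neg_neg]
  · rw [abs_le]
    rcases hcoord y hy i with h1 | h1 <;> rcases hcoord z hz i with h2 | h2 <;> omega

/-- If no side of the grid is a point, the vertices of some unit cube have all labels. -/
theorem exists_covering_cube {N : ℕ} {m : Fin N → ℕ} (hm : ∀ i, 2 ≤ m i)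
    (label : Grid m → Fin N → ℤˣ) (hlabel : IsAntipodal label) :
    ∃ S : Finset (Grid m), (∀ i v, ∃ x ∈ S, label x i = v) ∧
      ∀ x ∈ S, ∀ y ∈ S, ∀ i, |((x i : ℕ) : ℤ) - (y i : ℕ)| ≤ 1 := by
  classical
  have hm' : ∀ i, 1 ≤ m i := fun i => one_le_two.trans (hm i)
  let φ := roundToGrid hm'
  have hanti : ∀ i, AntipodalOnBoundary (fun i => m i - 1)
      fun y => if label (φ y) i = 1 then 1 else 0 := by
    rintro i y hy ⟨j, hj⟩
    -- The rounding is not odd at 0; sides of length at least 2 keep 0 off the boundary.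
    have h0 : y ≠ 0 := by
      rintro rfl
      have := hm j
      simp only [Pi.zero_apply, abs_zero] at hj
      omega
    simp only [φ, roundToGrid_neg hm' hy h0, hlabel _ (onBoundary_roundToGrid hm' hj),
      Pi.neg_apply]
    rcases Int.units_eq_one_or (label (roundToGrid hm' y) i) with h | h <;> rw [h] <;> decide
  obtain ⟨a, b, hab, h⟩ := exists_cube_forall_ne _ hanti
  refine ⟨(Fintype.piFinset fun i => {a i, b i}).image φ, fun i v => ?_, ?_⟩
  · obtain ⟨p, q, hp, hq, hpq⟩ := h i
    have hmem : ∀ p : Fin N → ℤ, (∀ j, p j = a j ∨ p j = b j) →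
        φ p ∈ (Fintype.piFinset fun i => {a i, b i}).image φ := fun p hp =>
      Finset.mem_image_of_mem φ (by simpa [Fintype.mem_piFinset] using hp)
    by_cases hv : label (φ p) i = v
    · exact ⟨φ p, hmem p hp, hv⟩
    · refine ⟨φ q, hmem q hq, ?_⟩
      by_contra hv'
      exact hpq (by rw [Int.units_ne_iff_eq_neg.1 hv, Int.units_ne_iff_eq_neg.1 hv'])
  · simp only [Finset.mem_image, Fintype.mem_piFinset, Finset.mem_insert, Finset.mem_singleton]
    rintro _ ⟨p, hp, rfl⟩ _ ⟨q, hq, rfl⟩ i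
    obtain ⟨h1, h2, h3⟩ := hab i
    apply abs_roundToGrid_sub_le hm'
    · rcases hp i with h | h <;> rwa [h]
    · rcases hq i with h | h <;> rwa [h]
    · rcases hp i with h | h <;> rcases hq i with h' | h' <;> rw [h, h']
      · simp
      · exact h3
      · rwa [abs_sub_comm]
      · simp

end StrongTucker

theorem mainTheorem11 (N : ℕ) (hN : 2 ≤ N) (m : Fin N → ℕ) (hm : ∀ i, 1 ≤ m i)
    (label : StrongTucker.Grid m → Fin N → ℤˣ) (hlabel : StrongTucker.IsAntipodal label) :
    ∃ z : Fin N → StrongTucker.Grid m,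
      StrongTucker.CoversAllLabels label z ∧
      ∀ j k : Fin N, ‖StrongTucker.toVec (z j) - StrongTucker.toVec (z k)‖ ≤ 1 := by
  obtain ⟨S, hS, hdist⟩ : ∃ S : Finset (StrongTucker.Grid m),
      (∀ i v, ∃ x ∈ S, label x i = v) ∧
      ∀ x ∈ S, ∀ y ∈ S, ∀ i, |((x i : ℕ) : ℤ) - (y i : ℕ)| ≤ 1 := by
    by_cases h : ∃ i, m i = 1
    · obtain ⟨i, hi⟩ := h
      exact StrongTucker.exists_covering_pair hm label hlabel hi
    · push Not at h
      exact StrongTucker.exists_covering_cube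
        (fun i => by have := hm i; have := h i; omega) label hlabel
  obtain ⟨z, hzS, hz⟩ := StrongTucker.exists_covering_family hN label S hS
  refine ⟨z, hz, fun j k => (pi_norm_le_iff_of_nonneg zero_le_one).2 fun i => ?_⟩
  rw [Pi.sub_apply, Real.norm_eq_abs]
  have h : |(((z j i : ℕ) : ℤ) : ℝ) - ((z k i : ℕ) : ℤ)| ≤ 1 := by
    exact_mod_cast hdist _ (hzS j) _ (hzS k) i
  simpa only [StrongTucker.toVec, Int.cast_natCast] using h
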